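/- Let $\omega$ satisfy $\omega^2+\omega+1=0$, with complex conjugate $\overline{\omega}=-1-\omega$, and let $$\gamma_0=\begin{pmatrix}0&1\\-1&\omega\end{pmatrix},\quad \gamma_0'=\begin{pmatrix}0&-1\\1&\omega\end{pmatrix},\quad \gamma_1=\begin{pmatrix}0&1\\-1&\overline{\omega}\end{pmatrix},\quad \gamma_1'=\begin{pmatrix}0&-1\\1&\overline{\omega}\end{pmatrix},$$ regarded as elements of $\mathrm{PSL}(2,\mathbb{Z}[\omega])$. Say that an element of $\mathrm{PSL}(2,\mathbb{Z}[\omega])$ has trace $t$ up to sign if it is represented by a matrix in $\mathrm{SL}(2,\mathbb{Z}[\omega])$ of trace $t$ or $-t$. Then in $\mathrm{PSL}(2,\mathbb{Z}[\omega])$ there are exactly two conjugacy classes of elements of trace $\omega$ (up to sign), namely those of $\gamma_0$ and $\gamma_0'$, and exactly two conjugacy classes of elements of trace $\overline{\omega}$ (up to sign), namely those of $\gamma_1$ and $\gamma_1'$. -/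

import Mathlib

open scoped MatrixGroups

/-- The ring `ℤ[ω]` with `ω² = -1 - ω`: pairs `re + im * ω` of integers. -/
abbrev Eisen : Type := QuadraticAlgebra ℤ (-1) (-1)

namespace Eisen

/-- The generator `ω` of `ℤ[ω]`. -/
def om : Eisen := ⟨0, 1⟩

/-- The complex conjugate `ω̄` of `ω` (`star` is complex conjugation on `ℤ[ω]`). -/
def omBar : Eisen := star om

theorem om_relation : om ^ 2 + om + 1 = 0 := by
  rw [pow_two]; ext <;> rfl

/-- For a root `z` of `X² + X + 1` in `ℂ`, the ring homomorphism `ℤ[ω] → ℂ` with `ω ↦ z`. -/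
noncomputable def toComplex (z : ℂ) (hz : z ^ 2 + z + 1 = 0) : Eisen →ₐ[ℤ] ℂ :=
  QuadraticAlgebra.lift ⟨z, by
    simp only [neg_smul, one_smul]
    linear_combination hz⟩

theorem toComplex_apply (z : ℂ) (hz : z ^ 2 + z + 1 = 0) (x : Eisen) :
    toComplex z hz x = x.re + x.im * z := by
  simp [toComplex, QuadraticAlgebra.lift]

theorem conj_root (z : ℂ) (hz : z ^ 2 + z + 1 = 0) :
    (starRingEnd ℂ) z = -1 - z ∧ z.im ≠ 0 := by
  have hre := congrArg Complex.re hz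
  have him := congrArg Complex.im hz
  simp only [pow_two, Complex.add_re, Complex.add_im, Complex.mul_re, Complex.mul_im,
    Complex.one_re, Complex.one_im, Complex.zero_re, Complex.zero_im] at hre him
  have h0 : z.im ≠ 0 := by
    intro h
    rw [h] at hre
    nlinarith [sq_nonneg (z.re + 1 / 2)]
  have h1 : z.re = -1 / 2 := by
    have : z.im * (2 * z.re + 1) = 0 := by linarith
    rcases mul_eq_zero.mp this with h | h
    · exact absurd h h0
    · linarith
  refine ⟨?_, h0⟩
  apply Complex.ext
  · simp only [Complex.conj_re, Complex.sub_re, Complex.neg_re, Complex.one_re]; linarith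
  · simp

/-- `Eisen` is the subring `ℤ[ω]` of `ℂ`: the map to `ℂ` is injective, and `star` goes to
complex conjugation. -/
theorem toComplex_injective (z : ℂ) (hz : z ^ 2 + z + 1 = 0) :
    Function.Injective (toComplex z hz) := by
  rw [injective_iff_map_eq_zero]
  intro x hx
  rw [toComplex_apply] at hx
  have h0 := (conj_root z hz).2
  have him := congrArg Complex.im hx
  have hre := congrArg Complex.re hx
  simp only [Complex.add_im, Complex.intCast_im, Complex.mul_im, Complex.intCast_re,
    Complex.add_re, Complex.mul_re, Complex.zero_im, Complex.zero_re, zero_mul, add_zero, zero_add,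
    sub_zero, mul_eq_zero, h0, or_false, Int.cast_eq_zero] at him hre
  rw [him] at hre
  simp only [Int.cast_zero, zero_mul, add_zero, Int.cast_eq_zero] at hre
  exact QuadraticAlgebra.ext hre him

theorem toComplex_star (z : ℂ) (hz : z ^ 2 + z + 1 = 0) (x : Eisen) :
    toComplex z hz (star x) = (starRingEnd ℂ) (toComplex z hz x) := by
  simp only [toComplex_apply, QuadraticAlgebra.re_star, QuadraticAlgebra.im_star, map_add,
    map_mul, map_intCast, (conj_root z hz).1]
  push_cast
  ring

/-- The class in `PSL(2, ℤ[ω])` of the matrix `(0 1; -1 t)`. -/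
def gam (t : Eisen) : PSL(2, Eisen) :=
  QuotientGroup.mk (⟨!![0, 1; -1, t], by simp [Matrix.det_fin_two_of]⟩ : SL(2, Eisen))

/-- The class in `PSL(2, ℤ[ω])` of the matrix `(0 -1; 1 t)`. -/
def gam' (t : Eisen) : PSL(2, Eisen) :=
  QuotientGroup.mk (⟨!![0, -1; 1, t], by simp [Matrix.det_fin_two_of]⟩ : SL(2, Eisen))

def gamma0 : PSL(2, Eisen) := gam om
def gamma0' : PSL(2, Eisen) := gam' om
def gamma1 : PSL(2, Eisen) := gam omBar
def gamma1' : PSL(2, Eisen) := gam' omBar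

/-- An element of `PSL(2, ℤ[ω])` has trace `t` up to sign: it is represented by a matrix in
`SL(2, ℤ[ω])` of trace `t` or `-t`. -/
def HasTrace (t : Eisen) (g : PSL(2, Eisen)) : Prop :=
  ∃ A : SL(2, Eisen), (QuotientGroup.mk A : PSL(2, Eisen)) = g ∧
    (A.1.trace = t ∨ A.1.trace = -t)

/-- The conjugacy classes of `PSL(2, ℤ[ω])` consisting of elements of trace `t` up to sign. -/
def traceClasses (t : Eisen) : Set (ConjClasses PSL(2, Eisen)) :=
  ConjClasses.mk '' {g | HasTrace t g}

end Eisen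

/-!
The argument is a reduction theory for the binary quadratic forms attached to the matrices of
trace `τ`, where `τ` is `ω` or `ω̄`.

Every class of trace `τ` up to sign has a representative `(a b; c d)` in `SL(2, ℤ[ω])` of trace
exactly `τ`, and then `(2a - τ)² + 4bc = τ² - 4`, an element of norm `21`. Conjugation by
translations changes `2a - τ` by multiples of `2c`, so one may assume
`3 N(2a - τ) ≤ N(2c)`, the square of the covering radius of the hexagonal lattice `ℤ[ω]` being
`1/3` (`exists_three_mul_norm_sub_mul_le`). With the parallelogram inequality this gives
`N(b) < N(c)` as soon as `N(c) ≥ 2`, and conjugation by `(0 1; -1 0)` exchanges the roles of `b`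
and `c` (`exists_isConj_norm_lt`). The descent cannot reach `c = 0`, since `τ` would then be the
sum of a unit and its conjugate, a rational integer. It therefore ends with a unit `c`, and then an
explicit matrix conjugates to `(0 1; -1 τ)` or `(0 -1; 1 τ)`, because the cube of a unit is `±1`
(`isConj_of_norm_eq_one`).

The two matrices are not conjugate up to a central factor, and this is already visible modulo the
prime `√-3` over `3`: the residue field is `ZMod 3`, `τ` becomes `1`, and a conjugating matrix with
first row `(a, b)` would have determinant `-(a² + ab + b²) = -(a - b)²`, which is not `1`
(`not_isConj_gam_gam'`).
-/

open Matrix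

namespace Eisen

/-! ### The norm on `ℤ[ω]` -/

theorem norm_eq (z : Eisen) : z.norm = z.re ^ 2 - z.re * z.im + z.im ^ 2 := by
  rw [QuadraticAlgebra.norm_def]; ring

theorem norm_nonneg (z : Eisen) : 0 ≤ z.norm := by
  rw [norm_eq]
  nlinarith [sq_nonneg (z.re - z.im), sq_nonneg z.re, sq_nonneg z.im]

theorem eq_zero_of_norm_eq_zero {z : Eisen} (h : z.norm = 0) : z = 0 := by
  rw [norm_eq] at h
  have h1 : z.re = 0 := by
    nlinarith [sq_nonneg (z.re - 2 * z.im), sq_nonneg z.re]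
  have h2 : z.im = 0 := by simpa [h1] using h
  exact QuadraticAlgebra.ext h1 h2

theorem norm_sub_le (x y : Eisen) : (x - y).norm ≤ 2 * x.norm + 2 * y.norm := by
  have h := norm_nonneg (x + y)
  simp only [norm_eq, QuadraticAlgebra.re_sub, QuadraticAlgebra.im_sub, QuadraticAlgebra.re_add,
    QuadraticAlgebra.im_add] at h ⊢
  linarith

/-- Points of the hexagon `|u|, |v|, |u + v| ≤ n` lie in its circumscribed circle. -/
theorem sq_add_mul_add_sq_le {u v n : ℤ} (hu : |u| ≤ n) (hv : |v| ≤ n) (huv : |u + v| ≤ n) :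
    u ^ 2 + u * v + v ^ 2 ≤ n ^ 2 := by
  have hu2 := sq_le_sq' (abs_le.mp hu).1 (abs_le.mp hu).2
  have hv2 := sq_le_sq' (abs_le.mp hv).1 (abs_le.mp hv).2
  have huv2 := sq_le_sq' (abs_le.mp huv).1 (abs_le.mp huv).2
  rcases le_total 0 (u * v) with h | h
  · nlinarith
  · rcases le_total 0 (u * (u + v)) with h' | h'
    · nlinarith
    · nlinarith

/-- Division with remainder in `ℤ[ω]`, with the optimal constant: the covering radius of the
hexagonal lattice is `1/√3`. -/
theorem exists_three_mul_norm_sub_mul_le (z : Eisen) {w : Eisen} (hw : w ≠ 0) :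
    ∃ q : Eisen, 3 * (z - q * w).norm ≤ w.norm := by
  let f : Eisen → ℕ := fun q => (z - q * w).norm.toNat
  let q := Function.argmin f
  refine ⟨q, ?_⟩
  have hmin : ∀ t : Eisen, (z - q * w).norm ≤ (z - q * w - t * w).norm := by
    intro t
    have h : f q ≤ f (q + t) := Function.argmin_le f (q + t)
    have h' := Int.toNat_le.mp h
    rw [Int.toNat_of_nonneg (norm_nonneg _)] at h'
    rwa [show z - q * w - t * w = z - (q + t) * w by ring]
  generalize z - q * w = r at hmin
  have hn : 0 < w.norm :=
    lt_of_le_of_ne (norm_nonneg w) fun h => hw (eq_zero_of_norm_eq_zero h.symm)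
  -- The minimality of `r` against the six neighbours `r - t w`, `t` a unit, puts
  -- `r w̄ = S + T ω` into the Voronoi hexagon.
  have h1 := hmin ⟨1, 0⟩
  have h2 := hmin ⟨-1, 0⟩
  have h3 := hmin ⟨0, 1⟩
  have h4 := hmin ⟨0, -1⟩
  have h5 := hmin ⟨1, 1⟩
  have h6 := hmin ⟨-1, -1⟩
  clear hmin
  obtain ⟨x, y⟩ := r
  obtain ⟨p, s⟩ := w
  simp only [norm_eq, QuadraticAlgebra.re_sub, QuadraticAlgebra.im_sub, QuadraticAlgebra.re_mul,
    QuadraticAlgebra.im_mul] at h1 h2 h3 h4 h5 h6 hn ⊢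
  set n := p ^ 2 - p * s + s ^ 2 with hn'
  set S := x * (p - s) + y * s with hS
  set T := y * p - x * s with hT
  have hu : |2 * S - T| ≤ n := abs_le.mpr ⟨by linarith, by linarith⟩
  have hv : |2 * T - S| ≤ n := abs_le.mpr ⟨by linarith, by linarith⟩
  have huv : |(2 * S - T) + (2 * T - S)| ≤ n := abs_le.mpr ⟨by linarith, by linarith⟩
  have key := sq_add_mul_add_sq_le hu hv huv
  have hmul : (2 * S - T) ^ 2 + (2 * S - T) * (2 * T - S) + (2 * T - S) ^ 2
      = n * (3 * (x ^ 2 - x * y + y ^ 2)) := by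
    rw [hS, hT, hn']; ring
  rw [hmul, sq n] at key
  exact le_of_mul_le_mul_left key hn

theorem cube_eq_one_or_neg_one {u : Eisen} (h : u.norm = 1) : u ^ 3 = 1 ∨ u ^ 3 = -1 := by
  obtain ⟨x, y⟩ := u
  simp only [norm_eq] at h
  have hx : -1 ≤ x ∧ x ≤ 1 := by
    constructor <;> nlinarith [sq_nonneg (x - 2 * y)]
  have hy : -1 ≤ y ∧ y ≤ 1 := by
    constructor <;> nlinarith [sq_nonneg (y - 2 * x)]
  obtain ⟨hx1, hx2⟩ := hx
  obtain ⟨hy1, hy2⟩ := hy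
  interval_cases x <;> interval_cases y <;> first | omega | decide

/-! ### Reduction of matrices of trace `τ` -/

/-- The matrix `(0 e; -e τ)` for a sign `e`; the signs `1` and `-1` give representatives of
`gam τ` and `gam' τ`. -/
def normalForm (τ e : Eisen) (he : e * e = 1) : SL(2, Eisen) :=
  ⟨!![0, e; -e, τ], by simp [Matrix.det_fin_two_of, he]⟩

theorem isConj_of_mul_eq_mul {G : Type*} [Group G] {p a b : G} (h : p * a = b * p) :
    IsConj a b :=
  isConj_iff.mpr ⟨p, by rw [h, mul_inv_cancel_right]⟩

theorem trace_eq_of_isConj {A B : SL(2, Eisen)} (h : IsConj A B) : B.1.trace = A.1.trace := by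
  obtain ⟨P, rfl⟩ := isConj_iff.mp h
  have h1 : (P * A * P⁻¹).1 = P.1 * A.1 * (P⁻¹).1 := rfl
  have h2 : (P⁻¹).1 * P.1 = 1 := congrArg Subtype.val (inv_mul_cancel P)
  rw [h1, Matrix.trace_mul_comm, ← Matrix.mul_assoc, h2, Matrix.one_mul]

/-- A matrix whose lower left entry is a unit is conjugate to a normal form. -/
theorem isConj_of_norm_eq_one {τ : Eisen} (A : SL(2, Eisen)) (hA : A.1.trace = τ)
    (hc : (A.1 1 0).norm = 1) :
    ∃ (e : Eisen) (he : e * e = 1), (e = 1 ∨ e = -1) ∧ IsConj A (normalForm τ e he) := by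
  have hdet := A.2
  rw [Matrix.trace_fin_two] at hA
  rw [Matrix.det_fin_two] at hdet
  set a := A.1 0 0
  set b := A.1 0 1
  set c := A.1 1 0
  set d := A.1 1 1
  obtain ⟨e, he, hce⟩ : ∃ e : Eisen, (e = 1 ∨ e = -1) ∧ -e * c ^ 3 = 1 := by
    rcases cube_eq_one_or_neg_one hc with h | h
    · exact ⟨-1, Or.inr rfl, by rw [h]; ring⟩
    · exact ⟨1, Or.inl rfl, by rw [h]; ring⟩
  have hee : e * e = 1 := by rcases he with rfl | rfl <;> ring
  -- A matrix `P` with `P * A = (0 e; -e τ) * P` is determined by its first row `x`, the second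
  -- one being `e x A`. For `x = (0, c)` its determinant is `-e c³`.
  let P : SL(2, Eisen) := ⟨!![0, c; e * c ^ 2, e * c * d], by
    rw [Matrix.det_fin_two_of]; linear_combination hce⟩
  refine ⟨e, hee, he, isConj_of_mul_eq_mul (p := P) (Subtype.ext ?_)⟩
  change P.1 * A.1 = (normalForm τ e hee).1 * P.1
  rw [Matrix.eta_fin_two A.1]
  change !![0, c; e * c ^ 2, e * c * d] * !![a, b; c, d]
    = !![0, e; -e, τ] * !![0, c; e * c ^ 2, e * c * d]
  rw [Matrix.mul_fin_two, Matrix.mul_fin_two]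
  have e1 : 0 * a + c * c = 0 * 0 + e * (e * c ^ 2) := by linear_combination -c ^ 2 * hee
  have e2 : 0 * b + c * d = 0 * c + e * (e * c * d) := by linear_combination -c * d * hee
  have e3 : e * c ^ 2 * a + e * c * d * c = -e * 0 + τ * (e * c ^ 2) := by
    linear_combination e * c ^ 2 * hA
  have e4 : e * c ^ 2 * b + e * c * d * d = -e * c + τ * (e * c * d) := by
    linear_combination e * c * d * hA - e * c * hdet
  rw [e1, e2, e3, e4]

/-- The descent step. -/
theorem exists_isConj_norm_lt {τ : Eisen} (hτ : (τ ^ 2 - 4).norm = 21) (A : SL(2, Eisen))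
    (hA : A.1.trace = τ) (hc : 2 ≤ (A.1 1 0).norm) :
    ∃ B : SL(2, Eisen), IsConj A B ∧ (B.1 1 0).norm < (A.1 1 0).norm := by
  have hdet := A.2
  rw [Matrix.trace_fin_two] at hA
  rw [Matrix.det_fin_two] at hdet
  have hAeta := Matrix.eta_fin_two A.1
  set a := A.1 0 0
  set b := A.1 0 1
  set c := A.1 1 0
  set d := A.1 1 1
  have h4 : ∀ z : Eisen, (4 * z).norm = 16 * z.norm := by
    intro z
    rw [map_mul]
    rfl
  have h2 : (2 * c).norm = 4 * c.norm := by
    rw [map_mul]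
    rfl
  have hc2 : 2 * c ≠ 0 := by
    intro h
    rw [h, QuadraticAlgebra.norm_zero] at h2
    omega
  obtain ⟨q, hq⟩ := exists_three_mul_norm_sub_mul_le (2 * a - τ) hc2
  -- `P` is the translation by `-q` followed by `(0 1; -1 0)`.
  let P : SL(2, Eisen) := ⟨!![0, 1; -1, q], by simp [Matrix.det_fin_two_of]⟩
  let b' := b + q * (a - d) - q ^ 2 * c
  let B : SL(2, Eisen) := ⟨!![d + q * c, -c; -b', a - q * c], by
    rw [Matrix.det_fin_two_of]; linear_combination hdet⟩
  refine ⟨B, isConj_of_mul_eq_mul (p := P) (Subtype.ext ?_), ?_⟩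
  · change P.1 * A.1 = B.1 * P.1
    rw [hAeta]
    change !![0, 1; -1, q] * !![a, b; c, d]
      = !![d + q * c, -c; -b', a - q * c] * !![0, 1; -1, q]
    rw [Matrix.mul_fin_two, Matrix.mul_fin_two]
    have e1 : 0 * a + 1 * c = (d + q * c) * 0 + -c * -1 := by ring
    have e2 : 0 * b + 1 * d = (d + q * c) * 1 + -c * q := by ring
    have e3 : -1 * a + q * c = -b' * 0 + (a - q * c) * -1 := by ring
    have e4 : -1 * b + q * d = -b' * 1 + (a - q * c) * q := by ring
    rw [e1, e2, e3, e4]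
  · change (-b').norm < c.norm
    rw [QuadraticAlgebra.norm_neg]
    rw [h2] at hq
    set Z := 2 * a - τ - q * (2 * c) with hZ
    have hdisc : 4 * (b' * c) = (τ ^ 2 - 4) - Z ^ 2 := by
      rw [hZ, ← hA]
      linear_combination -4 * hdet
    have hnorm := congrArg QuadraticAlgebra.norm hdisc
    rw [h4, map_mul] at hnorm
    have hle := norm_sub_le (τ ^ 2 - 4) (Z ^ 2)
    rw [← hnorm, hτ, map_pow] at hle
    have hZ0 := norm_nonneg Z
    by_contra! hlt
    -- With `n = N(c)`: `16 n² ≤ 42 + 2 (4n/3)²`, impossible for `n ≥ 2`.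
    nlinarith [mul_le_mul_of_nonneg_right hlt (norm_nonneg c)]

/-- A triangular matrix of determinant one has a rational integer as its trace: its diagonal
entries are a unit and the conjugate of that unit. -/
theorem im_trace_eq_zero {A : SL(2, Eisen)} (hc : A.1 1 0 = 0) : A.1.trace.im = 0 := by
  have hdet := A.2
  rw [Matrix.det_fin_two, hc, mul_zero, sub_zero] at hdet
  have hn := congrArg QuadraticAlgebra.norm hdet
  rw [map_mul, QuadraticAlgebra.norm_one] at hn
  have h1 : (A.1 0 0).norm = 1 := by
    rcases Int.mul_eq_one_iff_eq_one_or_neg_one.mp hn with h | h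
    · exact h.1
    · linarith [norm_nonneg (A.1 0 0), h.1]
  have h2 : A.1 0 0 * star (A.1 0 0) = 1 := by
    rw [← QuadraticAlgebra.algebraMap_norm_eq_mul_star, h1, map_one]
  have h3 : A.1 1 1 = star (A.1 0 0) := by
    linear_combination star (A.1 0 0) * hdet - A.1 1 1 * h2
  rw [Matrix.trace_fin_two, h3]
  simp

theorem exists_isConj_normalForm {τ : Eisen} (hτ : (τ ^ 2 - 4).norm = 21) (him : τ.im ≠ 0)
    (A : SL(2, Eisen)) (hA : A.1.trace = τ) :
    ∃ (e : Eisen) (he : e * e = 1), (e = 1 ∨ e = -1) ∧ IsConj A (normalForm τ e he) := by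
  induction hn : (A.1 1 0).norm.toNat using Nat.strong_induction_on generalizing A with
  | _ n ih =>
    have h0 := norm_nonneg (A.1 1 0)
    rcases lt_trichotomy (A.1 1 0).norm 1 with h | h | h
    · exact absurd (hA ▸ im_trace_eq_zero (eq_zero_of_norm_eq_zero (by omega))) him
    · exact isConj_of_norm_eq_one A hA h
    · obtain ⟨B, hAB, hlt⟩ := exists_isConj_norm_lt hτ A hA h
      obtain ⟨e, he, he', hB⟩ :=
        ih _ (by omega) B ((trace_eq_of_isConj hAB).trans hA) rfl
      exact ⟨e, he, he', hAB.trans hB⟩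

/-! ### Reduction modulo `√-3` -/

/-- Reduction modulo the prime `√-3` of `ℤ[ω]`, which sends `ω` to `1`. -/
noncomputable def toZModThree : Eisen →ₐ[ℤ] ZMod 3 :=
  QuadraticAlgebra.lift ⟨1, by simp; decide⟩

theorem toZModThree_apply (x : Eisen) : toZModThree x = x.re + x.im := by
  simp [toZModThree, QuadraticAlgebra.lift]

/-- Over `ZMod 3`, the matrices `(0 1; -1 1)` and `s (0 -1; 1 1)` are not conjugate under
`SL(2, ZMod 3)`: the hypotheses say that `P = (a b; c d)` has determinant `1` and satisfies
`s (0 -1; 1 1) P = P (0 1; -1 1)`, with signs and products arranged as `simp` leaves them. The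
traces force `s = 1`, and then `det P = -(a - b)²`. -/
theorem not_conjugate_over_zmod_three : ∀ a b c d s : ZMod 3, a * d - b * c = 1 →
    c * s = b → -(d * s) = a + b → (a + c) * s = -d → (b + d) * s = c + d → False := by
  decide

theorem not_isConj_gam_gam' {τ : Eisen} (hτ : toZModThree τ = 1) :
    ¬ IsConj (gam τ) (gam' τ) := by
  intro h
  obtain ⟨g, hg⟩ := isConj_iff.mp h
  obtain ⟨P, rfl⟩ := QuotientGroup.mk_surjective g
  rw [mul_inv_eq_iff_eq_mul] at hg
  obtain ⟨z, hz, hzP⟩ := QuotientGroup.mk'_eq_mk' _ |>.mp hg.symm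
  obtain ⟨r, -, hr⟩ := Matrix.SpecialLinearGroup.mem_center_iff.mp hz
  have hdet := congrArg toZModThree P.2
  rw [Matrix.det_fin_two] at hdet
  have hM := congrArg Subtype.val hzP
  change !![0, -1; 1, τ] * P.1 * z.1 = P.1 * !![0, 1; -1, τ] at hM
  rw [← hr, Matrix.eta_fin_two P.1] at hM
  have h00 := congrArg toZModThree (congrFun (congrFun hM 0) 0)
  have h01 := congrArg toZModThree (congrFun (congrFun hM 0) 1)
  have h10 := congrArg toZModThree (congrFun (congrFun hM 1) 0)
  have h11 := congrArg toZModThree (congrFun (congrFun hM 1) 1)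
  simp [Matrix.mul_apply, Fin.sum_univ_two, hτ] at h00 h01 h10 h11 hdet
  exact not_conjugate_over_zmod_three _ _ _ _ _ hdet h00 h01 h10 h11

/-! ### Classes in `PSL(2, ℤ[ω])` -/

theorem mk_neg (A : SL(2, Eisen)) :
    (QuotientGroup.mk (-A) : PSL(2, Eisen)) = QuotientGroup.mk A := by
  refine QuotientGroup.eq.mpr (Subgroup.mem_center_iff.mpr fun B => ?_)
  rw [inv_neg, neg_mul, inv_mul_cancel]
  simp

theorem traceClasses_eq {τ : Eisen} (hτ : (τ ^ 2 - 4).norm = 21) (him : τ.im ≠ 0) :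
    traceClasses τ = {ConjClasses.mk (gam τ), ConjClasses.mk (gam' τ)} := by
  ext x
  constructor
  · rintro ⟨_, ⟨A, rfl, hA⟩, rfl⟩
    obtain ⟨B, hBA, hB⟩ : ∃ B : SL(2, Eisen),
        (QuotientGroup.mk B : PSL(2, Eisen)) = QuotientGroup.mk A ∧ B.1.trace = τ := by
      rcases hA with h | h
      · exact ⟨A, rfl, h⟩
      · refine ⟨-A, mk_neg A, ?_⟩
        change (-A.1).trace = τ
        rw [Matrix.trace_neg, h, neg_neg]
    rw [← hBA]
    obtain ⟨e, he, he', hconj⟩ := exists_isConj_normalForm hτ him B hB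
    have hmk := (QuotientGroup.mk' (Subgroup.center SL(2, Eisen))).map_isConj hconj
    rcases he' with rfl | rfl
    · exact Or.inl (ConjClasses.mk_eq_mk_iff_isConj.mpr hmk)
    · refine Or.inr (ConjClasses.mk_eq_mk_iff_isConj.mpr ?_)
      have hform : normalForm τ (-1) he
          = ⟨!![0, -1; 1, τ], by simp [Matrix.det_fin_two_of]⟩ := by
        apply Subtype.ext
        change !![0, -1; - -1, τ] = !![0, -1; 1, τ]
        rw [neg_neg]
      rw [hform] at hmk
      exact hmk
  · rintro (rfl | rfl)
    · exact ⟨_, ⟨_, rfl, Or.inl (by simp [Matrix.trace_fin_two])⟩, rfl⟩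
    · exact ⟨_, ⟨_, rfl, Or.inl (by simp [Matrix.trace_fin_two])⟩, rfl⟩

theorem ncard_traceClasses {τ : Eisen} (hτ : (τ ^ 2 - 4).norm = 21) (him : τ.im ≠ 0)
    (h3 : toZModThree τ = 1) : (traceClasses τ).ncard = 2 := by
  rw [traceClasses_eq hτ him]
  exact Set.ncard_pair fun h => not_isConj_gam_gam' h3 (ConjClasses.mk_eq_mk_iff_isConj.mp h)

end Eisen

theorem mainTheorem9 :
    ((Eisen.traceClasses Eisen.om).ncard = 2 ∧
      Eisen.traceClasses Eisen.om =
        {ConjClasses.mk Eisen.gamma0, ConjClasses.mk Eisen.gamma0'}) ∧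
    ((Eisen.traceClasses Eisen.omBar).ncard = 2 ∧
      Eisen.traceClasses Eisen.omBar =
        {ConjClasses.mk Eisen.gamma1, ConjClasses.mk Eisen.gamma1'}) := by
  have hom : (Eisen.om ^ 2 - 4).norm = 21 := by decide
  have hom_bar : (Eisen.omBar ^ 2 - 4).norm = 21 := by decide
  have him : Eisen.om.im ≠ 0 := by decide
  have him_bar : Eisen.omBar.im ≠ 0 := by decide
  have h3 : Eisen.toZModThree Eisen.om = 1 := by
    rw [Eisen.toZModThree_apply]; decide
  have h3_bar : Eisen.toZModThree Eisen.omBar = 1 := by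
    rw [Eisen.toZModThree_apply]; decide
  exact ⟨⟨Eisen.ncard_traceClasses hom him h3, Eisen.traceClasses_eq hom him⟩,
    ⟨Eisen.ncard_traceClasses hom_bar him_bar h3_bar, Eisen.traceClasses_eq hom_bar him_bar⟩⟩
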